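/- Let $X$ be a complex Banach space and let $L(X)$ be the algebra of bounded linear operators on $X$. An element $a$ of a ring $R$ with identity is said to have a Drazin inverse if there is $b\in R$ such that $b=bab$, $b$ commutes with every element of $R$ that commutes with $a$, and $a-a^2b$ is nilpotent. The Drazin spectrum of $T\in L(X)$ is $$\sigma_D(T)=\{\lambda\in\mathbb{C} : \lambda I-T \text{ has no Drazin inverse in } L(X)\}.$$ If $A,B,C\in L(X)$ satisfy $$A(BA)^2=ABACA=ACABA=(AC)^2A,$$ then $\sigma_D(AC)=\sigma_D(BA)$. -/

import Mathlib

/-- The double commutant `comm²(a)`: all elements commuting with everything that commutes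
with `a`. -/
def doubleCommutant {R : Type*} [Ring R] (a : R) : Set R :=
  {x : R | ∀ y : R, y * a = a * y → x * y = y * x}

/-- `b` is a Drazin inverse of `a` in the ring `R`. -/
structure IsDrazinInverse {R : Type*} [Ring R] (a b : R) : Prop where
  outer : b = b * a * b
  mem_doubleCommutant : b ∈ doubleCommutant a
  isNilpotent : IsNilpotent (a - a ^ 2 * b)

/-- `a` has a Drazin inverse in `R`. -/
def HasDrazinInverse {R : Type*} [Ring R] (a : R) : Prop :=
  ∃ b : R, IsDrazinInverse a b

/-- The Drazin spectrum of an element of a unital complex algebra: all complex `z` such that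
`z - a` has no Drazin inverse. -/
def drazinSpectrum {𝔸 : Type*} [Ring 𝔸] [Algebra ℂ 𝔸] (a : 𝔸) : Set ℂ :=
  {z : ℂ | ¬ HasDrazinInverse (algebraMap ℂ 𝔸 z - a)}

/-! The hypotheses make any two words `A * X₁ * A * ⋯ * Xₙ * A` with letters `Xᵢ` in {`B`, `C`} and
the same `n ≥ 2` equal. Hence `B * A` and `A * C` are shift equivalent: some `S`, `T` intertwine
them, and `S * T`, `T * S` are equal powers of them. `HasDrazinInverse.of_shiftEquiv` carries a
commuting inverse `b` of high powers of `z - u` to one of `z - v`, built from `S * b * T`;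
`HasDrazinInverse.of_commute` upgrades it to a Drazin inverse. -/

/-- If `e = p * q = q * p` and `p * e = p = e * p`, then `e` commutes with everything that
commutes with `p`. -/
theorem Commute.of_local_unit {R : Type*} [Ring R] {p q e y : R} (hpq : p * q = e)
    (hqp : q * p = e) (hpe : p * e = p) (hep : e * p = p) (hy : Commute y p) :
    Commute e y := by
  have h₁ : e * y = e * y * e := by
    calc e * y = q * (y * p) := by rw [hy.eq, ← mul_assoc, hqp]
      _ = q * (y * p) * e := by rw [mul_assoc, mul_assoc, hpe]
      _ = e * y * e := by rw [hy.eq, ← mul_assoc, hqp]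
  have h₂ : y * e = e * y * e := by
    calc y * e = p * y * q := by rw [← hpq, ← mul_assoc, hy.eq]
      _ = e * (p * y) * q := by rw [← mul_assoc, hep]
      _ = e * y * e := by rw [← hy.eq, mul_assoc, mul_assoc y, hpq, ← mul_assoc]
  exact h₁.trans h₂.symm

/-- If `d` commutes with `a` and `d = d * a * d`, then powers of `a - a ^ 2 * d` are governed by
the idempotent `1 - a * d`. -/
theorem sub_sq_mul_pow {R : Type*} [Ring R] {a d : R} (had : Commute a d)
    (hout : d = d * a * d) (n : ℕ) :
    (a - a ^ 2 * d) ^ (n + 1) = a ^ (n + 1) - a ^ (n + 2) * d := by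
  have hid : IsIdempotentElem (a * d) := by
    rw [IsIdempotentElem, mul_assoc, ← mul_assoc d, ← hout]
  have hc : Commute a (1 - a * d) :=
    (Commute.one_right a).sub_right ((Commute.refl a).mul_right had)
  rw [show a - a ^ 2 * d = a * (1 - a * d) by noncomm_ring, hc.mul_pow,
    hid.one_sub.pow_succ_eq, mul_sub, mul_one, ← mul_assoc, ← pow_succ]

theorem pow_eq_pow_add_mul_pow {M : Type*} [Monoid M] {a b : M} {n : ℕ}
    (h : a ^ n = a ^ (n + 1) * b) (k : ℕ) : a ^ n = a ^ (n + k) * b ^ k := by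
  induction k with
  | zero => simp
  | succ k ih =>
    calc a ^ n = a ^ (n + 1) * b := h
      _ = a * a ^ n * b := by rw [pow_succ']
      _ = a * (a ^ (n + k) * b ^ k) * b := by rw [← ih]
      _ = a ^ (n + (k + 1)) * b ^ (k + 1) := by
        rw [pow_succ b, ← add_assoc, pow_succ' a]
        simp only [mul_assoc]

/-- A Drazin inverse from a commuting, but not necessarily outer, inverse of high powers. -/
theorem HasDrazinInverse.of_commute {R : Type*} [Ring R] {a b : R} (hab : Commute a b) {n : ℕ}
    (h : a ^ n = a ^ (n + 1) * b) : HasDrazinInverse a := by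
  -- The factor `a ^ n` removes the part of `b` on which `a` is nilpotent, which makes `d` outer.
  obtain ⟨d, hd⟩ : ∃ d, d = a ^ n * b ^ (n + 1) := ⟨_, rfl⟩
  have had : Commute a d := by
    rw [hd]
    exact ((Commute.refl a).pow_right n).mul_right (hab.pow_right _)
  have hnd : a ^ n = a ^ (n + 1) * d := by
    rw [hd, ← mul_assoc, ← pow_add, show n + 1 + n = n + (n + 1) by ring]
    exact pow_eq_pow_add_mul_pow h _
  have hout : d = d * a * d := by
    calc d = a ^ (n + 1) * d * b ^ (n + 1) := by rw [← hnd, hd]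
      _ = d * a * (a ^ n * b ^ (n + 1)) := by
        rw [(had.pow_left (n + 1)).eq, pow_succ' a n]; simp only [mul_assoc]
      _ = d * a * d := by rw [← hd]
  have hid : IsIdempotentElem (a * d) := by
    rw [IsIdempotentElem, mul_assoc, ← mul_assoc d, ← hout]
  -- `a ^ (n + 1)` is invertible in the corner of the idempotent `a * d`, so `a * d` lies in the
  -- double commutant of `a`, and then so does `d`.
  have hpq : a ^ (n + 1) * d ^ (n + 1) = a * d := by
    rw [← had.mul_pow, hid.pow_succ_eq]
  have hqp : d ^ (n + 1) * a ^ (n + 1) = a * d := by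
    rw [← hpq, (had.pow_pow _ _).eq]
  have hpe : a ^ (n + 1) * (a * d) = a ^ (n + 1) := by
    rw [((Commute.refl a).pow_left (n + 1)).left_comm, ← hnd, pow_succ']
  have hep : a * d * a ^ (n + 1) = a ^ (n + 1) := by
    rw [(((Commute.refl a).mul_left had.symm).pow_right (n + 1)).eq, hpe]
  refine ⟨d, hout, fun y hy => ?_, n + 1, ?_⟩
  · have he : a * d * y = y * (a * d) :=
      Commute.of_local_unit hpq hqp hpe hep (Commute.pow_right hy _)
    calc d * y = d * (a * d * y) := by rw [← mul_assoc, ← mul_assoc, ← hout]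
      _ = d * (y * a) * d := by rw [he]; simp only [mul_assoc]
      _ = a * d * y * d := by rw [hy, ← mul_assoc, had.eq]
      _ = y * (d * a * d) := by rw [he, had.eq, mul_assoc]
      _ = y * d := by rw [← hout]
  · rw [sub_sq_mul_pow had hout, pow_succ a (n + 1), mul_assoc, hpe, sub_self]

theorem HasDrazinInverse.exists_commute {R : Type*} [Ring R] {a : R} (h : HasDrazinInverse a) :
    ∃ b, Commute a b ∧ ∃ n, a ^ n = a ^ (n + 1) * b := by
  obtain ⟨b, hb, hcomm, n, hn⟩ := h
  have hab : Commute a b := (hcomm a rfl).symm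
  -- `sub_sq_mul_pow` covers positive exponents only, hence `n + 1`.
  refine ⟨b, hab, n + 1, sub_eq_zero.mp ?_⟩
  rw [← sub_sq_mul_pow hab hb, pow_succ, hn, zero_mul]

/-- Drazin invertibility of `z - u` is transported along a shift equivalence of lag `k`
between `u` and `v`; one direction needs only half of the equivalence. -/
theorem HasDrazinInverse.of_shiftEquiv {𝕜 R : Type*} [Field 𝕜] [Ring R] [Algebra 𝕜 R]
    {u v S T : R} {k : ℕ} (hS : S * u = v * S) (hT : T * v = u * T) (hST : S * T = v ^ k)
    {z : 𝕜} (h : HasDrazinInverse (algebraMap 𝕜 R z - u)) :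
    HasDrazinInverse (algebraMap 𝕜 R z - v) := by
  obtain ⟨b, hab, n, hn⟩ := h.exists_commute
  obtain ⟨a, ha⟩ : ∃ a, a = algebraMap 𝕜 R z - u := ⟨_, rfl⟩
  obtain ⟨t, ht⟩ : ∃ t, t = algebraMap 𝕜 R z - v := ⟨_, rfl⟩
  rw [← ha] at hab hn
  rw [← ht]
  have hSa : SemiconjBy S a t := by
    rw [SemiconjBy, ha, ht, mul_sub, sub_mul, hS, Algebra.commutes]
  have hTt : SemiconjBy T t a := by
    rw [SemiconjBy, ha, ht, mul_sub, sub_mul, hT, Algebra.commutes]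
  have hcomm : ∀ c, Commute a c → Commute t (S * c * T) := fun c hc =>
    ((hSa.mul_left hc.symm).mul_left hTt).symm
  -- At `z = 0`, `S * T = v ^ k` is `t ^ k` up to sign, so the exponent rises by `k`. For `z ≠ 0` it
  -- stays `n`.
  rcases eq_or_ne z 0 with rfl | hz
  · have hv : v = -1 * t := by simp [ht]
    have h₁ : t ^ (n + k + 1) * (S * b ^ (k + 1) * T) = t ^ n * v ^ k := by
      rw [← mul_assoc, ← mul_assoc, ← (hSa.pow_right _).eq, mul_assoc S, add_assoc,
        ← pow_eq_pow_add_mul_pow hn, (hSa.pow_right n).eq, mul_assoc, hST]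
    have hneg (m : ℕ) : Commute (t ^ m) ((-1) ^ k) := (Commute.neg_one_right _).pow_right k
    refine HasDrazinInverse.of_commute (b := (-1) ^ k * (S * b ^ (k + 1) * T)) (n := n + k)
      (((Commute.neg_one_right t).pow_right k).mul_right (hcomm _ (hab.pow_right _))) ?_
    rw [(hneg _).left_comm, h₁, hv, (Commute.neg_one_left t).mul_pow, (hneg n).left_comm,
      ← mul_assoc, ← (Commute.refl (-1 : R)).mul_pow, neg_one_mul, neg_neg, one_pow, one_mul,
      pow_add]
  · have htv : Commute t v := by
      rw [ht]
      exact (Algebra.commute_algebraMap_left z v).sub_left (Commute.refl v)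
    -- Since `t * q = z ^ k - v ^ k` and `t ^ (n + 1) * (S * b * T) = t ^ n * v ^ k`, the sum `q + S
    -- * b * T` inverts up to the scalar `z ^ k`.
    obtain ⟨q, hq⟩ : ∃ q, q = ∑ i ∈ Finset.range k, algebraMap 𝕜 R z ^ i * v ^ (k - 1 - i) :=
      ⟨_, rfl⟩
    have htq : t * q = algebraMap 𝕜 R (z ^ k) - v ^ k := by
      rw [ht, hq, (Algebra.commute_algebraMap_left z v).mul_geom_sum₂, map_pow]
    have hcq : Commute t q := by
      rw [hq]
      refine Commute.sum_right _ _ _ fun i _ => ?_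
      exact (((Algebra.commute_algebraMap_right z t).pow_right i)).mul_right (htv.pow_right _)
    refine HasDrazinInverse.of_commute (b := (z ^ k)⁻¹ • (q + S * b * T)) (n := n)
      ((hcq.add_right (hcomm b hab)).smul_right _) ?_
    have h₁ : t ^ (n + 1) * (S * b * T) = t ^ n * v ^ k := by
      rw [← mul_assoc, ← mul_assoc, ← (hSa.pow_right (n + 1)).eq, mul_assoc S, ← hn,
        (hSa.pow_right n).eq, mul_assoc, hST]
    rw [mul_smul_comm, mul_add, h₁, pow_succ, mul_assoc, htq, ← mul_add, sub_add_cancel,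
      ← Algebra.commutes, ← Algebra.smul_def, smul_smul, inv_mul_cancel₀ (pow_ne_zero k hz),
      one_smul]

/-- Elements related by a shift equivalence have the same Drazin spectrum. -/
theorem drazinSpectrum_eq_of_shiftEquiv {R : Type*} [Ring R] [Algebra ℂ R]
    {u v S T : R} {k : ℕ} (hS : S * u = v * S) (hT : T * v = u * T) (hST : S * T = v ^ k)
    (hTS : T * S = u ^ k) : drazinSpectrum u = drazinSpectrum v := by
  ext z
  exact not_congr ⟨.of_shiftEquiv hS hT hST, .of_shiftEquiv hT hS hTS⟩

theorem theorem3p5 {X : Type*} [NormedAddCommGroup X] [NormedSpace ℂ X] [CompleteSpace X]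
    (A B C : X →L[ℂ] X)
    (h₁ : A * (B * A) ^ 2 = A * B * A * C * A)
    (h₂ : A * B * A * C * A = A * C * A * B * A)
    (h₃ : A * C * A * B * A = (A * C) ^ 2 * A) :
    drazinSpectrum (A * C) = drazinSpectrum (B * A) := by
  have hBC : A * (B * (A * (C * A))) = A * (B * (A * (B * A))) := by
    simpa only [pow_two, mul_assoc] using h₁.symm
  have hCB : A * (C * (A * (B * A))) = A * (B * (A * (B * A))) := by
    rw [← hBC]; simpa only [mul_assoc] using h₂.symm
  have hCC : A * (C * (A * (C * A))) = A * (B * (A * (B * A))) := by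
    rw [← hCB]; simpa only [pow_two, mul_assoc] using h₃.symm
  -- Right-associated forms, so that `simp` can rewrite inside longer words.
  have hBC' (Y) : A * (B * (A * (C * (A * Y)))) = A * (B * (A * (B * (A * Y)))) := by
    simpa only [mul_assoc] using congrArg (· * Y) hBC
  have hCB' (Y) : A * (C * (A * (B * (A * Y)))) = A * (B * (A * (B * (A * Y)))) := by
    simpa only [mul_assoc] using congrArg (· * Y) hCB
  have hCC' (Y) : A * (C * (A * (C * (A * Y)))) = A * (B * (A * (B * (A * Y)))) := by
    simpa only [mul_assoc] using congrArg (· * Y) hCC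
  -- `S` begins and ends with `A`, while `T` begins with `B` and ends with `C`, so both sides of
  -- each identity have the same outer letters; `simp` turns the inner ones into `B`. The lag counts
  -- the letters other than `A`: two in `S`, three in `T`.
  refine (drazinSpectrum_eq_of_shiftEquiv (u := B * A) (v := A * C) (S := A * C * A * B * A)
    (T := B * A * C * A * C) (k := 5) ?_ ?_ ?_ ?_).symm <;>
  simp only [pow_succ, pow_zero, one_mul, mul_assoc, hCB, hBC', hCB', hCC']
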